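/- **Setting.** For every ordinal $\alpha$ with $0<\alpha<\aleph_1$ fix a non-decreasing sequence $\langle\gamma^\alpha_n : n\in\mathbb N\rangle$ of ordinals with $\bigcup_n(\gamma^\alpha_n+1)=\alpha$, and with $\gamma^\alpha_n\ge 1$ for all $n$ if $\alpha>1$. Define sets of finite sequences of natural numbers by $S_0=\{\emptyset\}$ and $S_\alpha=\{n^\frown s : n\in\mathbb N,\ s\in S_{\gamma^\alpha_n}\}$ for $\alpha>0$ (so $S_1$ is the set of sequences of length $1$). For a set $X$ of finite sequences let $X(s)=\{s' : s^\frown s'\in X\}$ and let $\mathrm{Dom}(X)$ be the set of proper initial segments of elements of $X$. Let $\mathrm{Fin}^1$ be the ideal of finite subsets of $S_1$ and, for $1<\alpha<\aleph_1$, let $X\subseteq S_\alpha$ belong to $\mathrm{Fin}^\alpha$ iff $\{n : X(\langle n\rangle)\notin \mathrm{Fin}^{\gamma^\alpha_n}\}$ is finite. A set $X\subseteq S_\alpha$ is in $(\mathrm{Fin}^\alpha)^{++}$ iff $X\notin\mathrm{Fin}^\alpha$ and for every $s\in\mathrm{Dom}(X)$ the set $\{n : s^\frown n\in \mathrm{Dom}(X)\cup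 X\}$ is infinite. A $\mathrm{Fin}^\alpha$-almost disjoint family is a set $\mathcal A\subseteq\mathcal P(S_\alpha)\setminus\mathrm{Fin}^\alpha$ any two distinct members of which have intersection in $\mathrm{Fin}^\alpha$; it is maximal if it is not a proper subset of another such family. For $X\in(\mathrm{Fin}^\alpha)^{++}$ define a partial function $\hat X$ from finite sequences to $S_\alpha$: $\hat X(s)=t$ iff $t\in S_\alpha$ has the same length as $s$ and, for each $n$ below this length, $t(n)$ is the $s(n)$-th element (counting from $0$, in increasing order) of the set of all $k$ such that $(t\restriction n)^\frown k$ is an initial segment of an element of $X$. For a finite $a\subseteq\mathbb N$ let $\hat a$ be its increasing enumeration. For $\vec x=\langle x^l : l\in\mathbb N\rangle$ with all $x^l\in(\mathrm{Fin}^\alpha)^{++}$ and infinite $A\subseteq\mathbb N$, let $\widetilde{A}$ be the set of all $\hat x^l(\hat a)$ where $l\in A$, $a\subseteq A$ is finite and non-empty, $\min a$ is the least element of $A$ greater than $l$, and $\hat a\in\mathrm{dom}(\hat x^l)$. **Theorem.** Let $0<\alpha<\aleph_1$, let $\mathcal A$ be a $\mathrm{Fin}^\alpha$-almost disjoint family that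 is analytic (as a subset of $\mathcal P(S_\alpha)\cong 2^{S_\alpha}$), and let $\vec x=\langle x^l : l\in\mathbb N\rangle$ be a sequence of pairwise disjoint sets in $(\mathrm{Fin}^\alpha)^{++}$ such that there are pairwise distinct $\bar A^l\in\mathcal A$ $(l\in\mathbb N)$ with $x^l\subseteq\bar A^l$ for all $l$. Then for every infinite $W\subseteq\mathbb N$ there is an infinite $W_0\subseteq W$ such that $\widetilde{W_0}\cap \bar A\in\mathrm{Fin}^\alpha$ for every $\bar A\in\mathcal A$. Moreover, $\mathcal A$ is not maximal. -/

import Mathlib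

open Set Ordinal

/-- A choice, for every ordinal `0 < α < ω₁`, of a non-decreasing sequence `γ^α_0, γ^α_1, …` of
ordinals with `⋃ₙ (γ^α_n + 1) = α`; an ordinal being the set of smaller ordinals, this says that
`β < α` iff `β ≤ γ^α_n` for some `n`. For `α > 1` the entries are at least `1`, so that the
recursion for the ideals `Fin^α` starts from `Fin^1`. -/
structure LadderSystem where
  seq : Ordinal.{0} → ℕ → Ordinal.{0}
  monotone_seq : ∀ α, 0 < α → α < ω₁ → Monotone (seq α)
  lt_iff : ∀ α, 0 < α → α < ω₁ → ∀ β, β < α ↔ ∃ n, β ≤ seq α n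
  seq_pos : ∀ α, 1 < α → α < ω₁ → ∀ n, 0 < seq α n

namespace LadderSystem

theorem seq_lt (L : LadderSystem) {α : Ordinal.{0}} (h0 : 0 < α) (h1 : α < ω₁) (n : ℕ) :
    L.seq α n < α :=
  (L.lt_iff α h0 h1 _).2 ⟨n, le_rfl⟩

/-- Membership in the set `S_α` of finite sequences: `S_0 = {∅}` and, for `α > 0`,
`S_α = {n⌢s | n ∈ ℕ, s ∈ S_{γ^α_n}}`. Since `γ^1_n = 0`, the set `S_1` consists of the
sequences of length one. -/
def MemS (L : LadderSystem) : Ordinal.{0} → List ℕ → Prop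
  | α, [] => α = 0
  | α, n :: s => 0 < α ∧ MemS L (L.seq α n) s

/-- The set `S_α`. -/
def S (L : LadderSystem) (α : Ordinal.{0}) : Set (List ℕ) := {s | L.MemS α s}

end LadderSystem

/-- The section `X(s) = {s' | s⌢s' ∈ X}`. -/
def sectionAt (X : Set (List ℕ)) (s : List ℕ) : Set (List ℕ) := {s' | s ++ s' ∈ X}

/-- The higher dimensional domain: all proper initial segments of elements of `X`. -/
def higherDom (X : Set (List ℕ)) : Set (List ℕ) :=
  {t | ∃ s ∈ X, ∃ k < s.length, t = s.take k}

/-- `m` is the `k`-th element (starting from `0`) of `Y` in increasing order; in particular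
`k` is smaller than the cardinality of `Y`. -/
def IsEnum (Y : Set ℕ) (k m : ℕ) : Prop :=
  (∀ hf : Y.Finite, k < hf.toFinset.card) ∧ Nat.nth (fun j => j ∈ Y) k = m

/-- `l` and `m` are consecutive elements of `A`. -/
def Consec (A : Set ℕ) (l m : ℕ) : Prop := l ∈ A ∧ IsLeast {k | k ∈ A ∧ l < k} m

namespace LadderSystem

open Classical in
/-- The ideal `Fin^α` on `S_α`, for `0 < α < ω₁`: `Fin^1` consists of the finite subsets of `S_1`;
for `α > 1`, a set `X ⊆ S_α` is in `Fin^α` iff `X(⟨n⟩) ∉ Fin^{γ^α_n}` for only finitely many `n`.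
(Values at other `α` are never used.) -/
noncomputable def finIdeal (L : LadderSystem) (α : Ordinal.{0}) : Set (Set (List ℕ)) :=
  if _h : 1 < α ∧ α < ω₁ then
    {X | X ⊆ L.S α ∧ {n : ℕ | sectionAt X [n] ∉ finIdeal L (L.seq α n)}.Finite}
  else
    {X | X ⊆ L.S α ∧ X.Finite}
termination_by α
decreasing_by exact L.seq_lt (lt_trans zero_lt_one _h.1) _h.2 n

theorem mem_finIdeal_one (L : LadderSystem) (X : Set (List ℕ)) :
    X ∈ L.finIdeal 1 ↔ X ⊆ L.S 1 ∧ X.Finite := by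
  rw [finIdeal, dif_neg (fun h => lt_irrefl _ h.1)]
  rfl

theorem mem_finIdeal_of_one_lt (L : LadderSystem) {α : Ordinal.{0}} (h1 : 1 < α) (h2 : α < ω₁)
    (X : Set (List ℕ)) :
    X ∈ L.finIdeal α ↔
      X ⊆ L.S α ∧ {n : ℕ | sectionAt X [n] ∉ L.finIdeal (L.seq α n)}.Finite := by
  rw [finIdeal, dif_pos ⟨h1, h2⟩]
  rfl

/-- The co-ideal of `Fin^α`-positive subsets of `S_α`. -/
def finPos (L : LadderSystem) (α : Ordinal.{0}) : Set (Set (List ℕ)) :=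
  {X | X ⊆ L.S α ∧ X ∉ L.finIdeal α}

/-- The sets `X` that are positive and such that every `s` in the higher dimensional domain
of `X` has infinitely many immediate successors in the tree of initial segments of `X`. -/
def finPosPos (L : LadderSystem) (α : Ordinal.{0}) : Set (Set (List ℕ)) :=
  {X | X ∈ L.finPos α ∧
    ∀ s ∈ higherDom X, {n : ℕ | s ++ [n] ∈ higherDom X ∪ X}.Infinite}

/-- `𝒜` is a `Fin^α`-almost disjoint family. -/
def IsAlmostDisjointFamily (L : LadderSystem) (α : Ordinal.{0}) (𝒜 : Set (Set (List ℕ))) : Prop :=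
  (∀ A ∈ 𝒜, A ∈ L.finPos α) ∧ ∀ A ∈ 𝒜, ∀ B ∈ 𝒜, A ≠ B → A ∩ B ∈ L.finIdeal α

/-- The graph of the partial function `X̂` from finite sequences to `S_α`: `X̂(s) = t` iff `t ∈ S_α`
has the same length as `s` and, for each `n` below this length, `t(n)` is the `s(n)`-th
element of the set of those `k` such that `(t ↾ n)⌢k` is an initial segment of an element
of `X`. -/
def HatGraph (L : LadderSystem) (α : Ordinal.{0}) (X : Set (List ℕ)) (s t : List ℕ) : Prop :=
  t ∈ L.S α ∧ ∃ hl : t.length = s.length, ∀ (n : ℕ) (hn : n < s.length),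
    IsEnum {k | ∃ s', t.take n ++ k :: s' ∈ X} (s[n]) (t[n]'(hl ▸ hn))

/-- The tilde operator associated with a sequence `x` of subsets of `S_α`: the image of `A` is
the set of all `x̂^l(â)`, where `l ∈ A`, `a ⊆ A` is finite and non-empty, `l` and `min a` are
consecutive elements of `A`, and the increasing enumeration `â` of `a` lies in the domain of
`x̂^l`. -/
def tilde (L : LadderSystem) (α : Ordinal.{0}) (x : ℕ → Set (List ℕ)) (A : Set ℕ) :
    Set (List ℕ) :=
  {t | ∃ (l : ℕ) (a : Finset ℕ) (ha : a.Nonempty), l ∈ A ∧ (a : Set ℕ) ⊆ A ∧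
    Consec A l (a.min' ha) ∧ L.HatGraph α (x l) (a.sort (· ≤ ·)) t}

end LadderSystem

/-- A family of sets of finite sequences is analytic: the corresponding set of characteristic
functions is an analytic subset of the Polish space `2^(List ℕ)` (product of discrete spaces). For
families of subsets of `S_α` this is the same as being analytic in the closed subspace of
subsets of `S_α`. -/
def IsAnalyticFamily (𝒜 : Set (Set (List ℕ))) : Prop :=
  MeasureTheory.AnalyticSet {f : List ℕ → Bool | {s | f s = true} ∈ 𝒜}

/-! Suppose no infinite subset of `W` works, so for every infinite `C ⊆ W` some member of `𝒜` meets
the tilde image of `C` positively. By analyticity, `𝒜` is the range of a continuous `φ` on Baire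
space. The plan is to build two distinct members of `𝒜` whose intersection is positive, against
almost disjointness.

A condition consists of a finite sequence `t`, which approximates a code, and a finite set `F` of
nodes of the trees `x l` promised to be positive. It is large if it is not `NeverCaught`. There are
countably many conditions, so one infinite set decides the largeness of all of them hereditarily
(`exists_forall_neverCaught`). For a large condition, `t` can be lengthened, and a promised node
that is not a leaf can be given all but finitely many of its successors as further promises. New
nodes of length one can also be promised: otherwise a homogeneous set would contain no promisable
pair, although its tilde image is met positively. As exceptions are few, two large conditions with
the same `F` can be extended by the same promises.

Each member of `𝒜` is positive in at most one `x l`. Hence a set catching a sufficiently sparse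
index set differs from a given one, which yields two starting sequences that force distinct members.
The generic branches above them (`exists_generic_branches`) fulfil the same tree of promises, so the
two members have positive intersection (`exists_positive_inter`).

For non-maximality, the tilde image of `W₀` is itself positive (`positive_tilde`) and can be added
to `𝒜`. -/

/-! ### Diagonalisation over infinite sets of naturals -/

/-- Each new element is taken from the set indexed by the value of the previous one; since `C`
decreases, it then lies in the sets indexed by all earlier elements. -/
theorem exists_diagonal (C : ℕ → Set ℕ) (hC : Antitone C) (hinf : ∀ n, (C n).Infinite) :
    ∃ D ⊆ C 0, D.Infinite ∧ ∀ l ∈ D, ∀ m ∈ D, l < m → m ∈ C l := by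
  choose next hmem hlt using fun n : ℕ => (hinf n).exists_gt n
  let c : ℕ → ℕ := fun n => Nat.rec (next 0) (fun _ k => next k) n
  have hc : ∀ n, c (n + 1) = next (c n) := fun _ => rfl
  have hmono : StrictMono c := strictMono_nat_of_lt_succ fun n => by rw [hc]; exact hlt _
  refine ⟨range c, ?_, infinite_range_of_injective hmono.injective, ?_⟩
  · rintro _ ⟨n, rfl⟩
    cases n with
    | zero => exact hmem 0
    | succ n => exact hC (Nat.zero_le _) (hmem (c n))
  · rintro _ ⟨i, rfl⟩ _ ⟨j, rfl⟩ hij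
    have hij' : i < j := hmono.lt_iff_lt.1 hij
    cases j with
    | zero => omega
    | succ j => exact hC (hmono.monotone (Nat.lt_succ_iff.1 hij')) (hmem (c j))

theorem exists_homogeneous (B : Set ℕ) (hB : B.Infinite) (R : ℕ → ℕ → Prop)
    (hR : ∀ l ∈ B, ∃ N, ∀ m ∈ B, N < m → R l m) :
    ∃ D ⊆ B, D.Infinite ∧ ∀ l ∈ D, ∀ m ∈ D, l < m → R l m := by
  have hR' : ∀ l, ∃ N, ∀ m ∈ B, N < m → l ∈ B → R l m := fun l => by
    by_cases hl : l ∈ B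
    · obtain ⟨N, hN⟩ := hR l hl
      exact ⟨N, fun m hm h _ => hN m hm h⟩
    · exact ⟨0, fun m _ _ h => absurd h hl⟩
  choose N hN using hR'
  obtain ⟨D, hDs, hDi, hD⟩ := exists_diagonal (fun l => {m | m ∈ B ∧ ∀ i ≤ l, N i < m})
    (fun a b hab m hm => ⟨hm.1, fun i hi => hm.2 i (hi.trans hab)⟩) (fun l => by
      refine infinite_of_forall_exists_gt fun a => ?_
      obtain ⟨m, hm, hlt⟩ := hB.exists_gt (a + ∑ i ∈ Finset.range (l + 1), N i)
      refine ⟨m, ⟨hm, fun i hi => ?_⟩, by omega⟩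
      have := Finset.single_le_sum (f := N) (fun _ _ => Nat.zero_le _)
        (Finset.mem_range.2 (show i < l + 1 by omega))
      omega)
  have hDB : D ⊆ B := fun m hm => (hDs hm).1
  exact ⟨D, hDB, hDi, fun l hl m hm hlm => hN l m (hDB hm) ((hD l hl m hm hlm).2 l le_rfl) (hDB hl)⟩

/-- Countably many families of infinite sets of naturals which are dense and open modulo finite
sets have a dense intersection. -/
theorem exists_mem_forall_of_dense {ι : Type*} [Countable ι] (𝒟 : ι → Set (Set ℕ)) (B : Set ℕ)
    (hB : B.Infinite)
    (hdense : ∀ i, ∀ C ⊆ B, C.Infinite → ∃ C' ⊆ C, C'.Infinite ∧ C' ∈ 𝒟 i)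
    (hdown : ∀ i, ∀ C ∈ 𝒟 i, ∀ C' ⊆ C, C' ∈ 𝒟 i)
    (htail : ∀ i N C, C ∩ Ioi N ∈ 𝒟 i → C ∈ 𝒟 i) :
    ∃ C ⊆ B, C.Infinite ∧ ∀ i, C ∈ 𝒟 i := by
  rcases isEmpty_or_nonempty ι with hι | hι
  · exact ⟨B, Subset.rfl, hB, fun i => hι.elim i⟩
  obtain ⟨e, he⟩ := exists_surjective_nat ι
  have step : ∀ (n : ℕ) (C : {C : Set ℕ // C ⊆ B ∧ C.Infinite}),
      ∃ C' : {C : Set ℕ // C ⊆ B ∧ C.Infinite}, C'.1 ⊆ C.1 ∧ C'.1 ∈ 𝒟 (e n) := fun n C => by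
    obtain ⟨C', h1, h2, h3⟩ := hdense (e n) C.1 C.2.1 C.2.2
    exact ⟨⟨C', h1.trans C.2.1, h2⟩, h1, h3⟩
  choose next hsub hmem using step
  let c : ℕ → {C : Set ℕ // C ⊆ B ∧ C.Infinite} :=
    fun n => Nat.rec ⟨B, Subset.rfl, hB⟩ (fun k C => next k C) n
  have hc : ∀ n, c (n + 1) = next n (c n) := fun _ => rfl
  have hanti : Antitone fun n => (c n).1 :=
    antitone_nat_of_succ_le fun n => by rw [hc]; exact hsub _ _
  obtain ⟨D, hD0, hDi, hD⟩ := exists_diagonal (fun n => (c n).1) hanti fun n => (c n).2.2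
  refine ⟨D, hD0.trans (c 0).2.1, hDi, fun i => ?_⟩
  obtain ⟨n, rfl⟩ := he i
  obtain ⟨d, hd, hdn⟩ := hDi.exists_gt (n + 1)
  -- Past an element `d > n + 1`, the diagonal set lies inside `c d ⊆ c (n + 1)`, which meets
  -- requirement `n`.
  refine htail _ d D (hdown _ _ (hmem n (c n)) _ fun m hm => ?_)
  have : m ∈ (c (n + 1)).1 := hanti hdn.le (hD d hd m hm.1 hm.2)
  rwa [hc] at this

/-- Enumerating `ι × ℕ` instead of `ι` makes every requirement recur infinitely often, so that
requirements which become relevant only late are still served. -/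
theorem exists_chain {ι P : Type*} [Countable ι] [Nonempty ι] (r : P → P → Prop) (𝒟 : ι → Set P)
    (hD : ∀ i p, ∃ q, r p q ∧ q ∈ 𝒟 i) (p₀ : P) :
    ∃ f : ℕ → P, f 0 = p₀ ∧ (∀ n, r (f n) (f (n + 1))) ∧ ∀ i N, ∃ n, N < n ∧ f n ∈ 𝒟 i := by
  obtain ⟨e, he⟩ := exists_surjective_nat (ι × ℕ)
  choose next hr hmem using fun (n : ℕ) (p : P) => hD (e n).1 p
  let f : ℕ → P := fun n => Nat.rec p₀ (fun k p => next k p) n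
  have hf : ∀ n, f (n + 1) = next n (f n) := fun _ => rfl
  refine ⟨f, rfl, fun n => by rw [hf]; exact hr _ _, fun i N => ?_⟩
  have hinf : {n | (e n).1 = i}.Infinite := by
    intro hfin
    have : (e '' {n | (e n).1 = i}).Finite := hfin.image e
    refine this.not_infinite ((infinite_range_of_injective
      (Prod.mk_right_injective i : Function.Injective (fun k : ℕ => (i, k)))).mono ?_)
    rintro _ ⟨k, rfl⟩
    obtain ⟨n, hn⟩ := he (i, k)
    exact ⟨n, by simp [hn], hn⟩
  obtain ⟨n, hn, hlt⟩ := hinf.exists_gt N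
  refine ⟨n + 1, by omega, ?_⟩
  have hn' : (e n).1 = i := hn
  rw [hf, ← hn']
  exact hmem n (f n)

/-! ### Positivity without ordinals -/

/-- The first coordinates of the elements of `X`. -/
def succs (X : Set (List ℕ)) : Set ℕ := {k | ∃ s, k :: s ∈ X}

/-- The `m`-th first coordinate of the elements of `X`. -/
noncomputable def child (X : Set (List ℕ)) (m : ℕ) : ℕ := Nat.nth (fun j => j ∈ succs X) m

theorem child_mem {X : Set (List ℕ)} (h : (succs X).Infinite) (m : ℕ) : child X m ∈ succs X :=
  Nat.nth_mem_of_infinite h m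

theorem child_strictMono {X : Set (List ℕ)} (h : (succs X).Infinite) : StrictMono (child X) :=
  Nat.nth_strictMono h

theorem sectionAt_sectionAt (X : Set (List ℕ)) (s t : List ℕ) :
    sectionAt (sectionAt X s) t = sectionAt X (s ++ t) := by
  ext r; simp [sectionAt]

/-- Positivity with respect to the ideals `Fin^α`, without reference to `α`. -/
inductive Positive : Set (List ℕ) → Prop
  | leaf {Y : Set (List ℕ)} : [] ∈ Y → Positive Y
  | node {Y : Set (List ℕ)} (M : Set ℕ) : M.Infinite →
      (∀ k ∈ M, Positive (sectionAt Y [k])) → Positive Y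

namespace Positive

theorem nonempty {Y : Set (List ℕ)} (h : Positive Y) : Y.Nonempty := by
  induction h with
  | leaf h => exact ⟨_, h⟩
  | node M hM _ ih =>
    obtain ⟨k, hk⟩ := hM.nonempty
    obtain ⟨s, hs⟩ := ih k hk
    exact ⟨_, hs⟩

theorem mono {Y Z : Set (List ℕ)} (h : Positive Y) (hYZ : Y ⊆ Z) : Positive Z := by
  induction h generalizing Z with
  | leaf h => exact .leaf (hYZ h)
  | node M hM _ ih => exact .node M hM fun k hk => ih k hk fun s hs => hYZ hs

theorem infinite_of_nil_notMem {Y : Set (List ℕ)} (h : Positive Y) (h0 : [] ∉ Y) :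
    {k | Positive (sectionAt Y [k])}.Infinite := by
  cases h with
  | leaf h => exact absurd h h0
  | node M hM h => exact hM.mono h

theorem or_of_union {Y Z X : Set (List ℕ)} (h : Positive X) (hX : X ⊆ Y ∪ Z) :
    Positive Y ∨ Positive Z := by
  induction h generalizing Y Z with
  | leaf h => exact (hX h).imp .leaf .leaf
  | @node X M hM _ ih =>
    have hk : M ⊆ {k | Positive (sectionAt Y [k])} ∪ {k | Positive (sectionAt Z [k])} :=
      fun k hk => ih k hk (Y := sectionAt Y [k]) (Z := sectionAt Z [k]) fun s hs => hX hs
    exact (infinite_union.1 (hM.mono hk)).imp (fun h => .node _ h fun _ h => h)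
      fun h => .node _ h fun _ h => h

theorem exists_of_biUnion (f : ℕ → Set (List ℕ)) (n : ℕ) {X : Set (List ℕ)} (h : Positive X)
    (hX : ∀ s ∈ X, ∃ i < n, s ∈ f i) : ∃ i < n, Positive (f i) := by
  induction n generalizing X with
  | zero =>
    obtain ⟨s, hs⟩ := h.nonempty
    obtain ⟨i, hi, _⟩ := hX s hs
    omega
  | succ n ih =>
    rcases h.or_of_union (Y := {s ∈ X | ∃ i < n, s ∈ f i}) (Z := f n) (fun s hs => by
      obtain ⟨i, hi, hsi⟩ := hX s hs
      rcases Nat.lt_succ_iff_lt_or_eq.1 hi with hi | rfl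
      · exact Or.inl ⟨hs, i, hi, hsi⟩
      · exact Or.inr hsi) with h | h
    · obtain ⟨i, hi, h⟩ := ih h fun s hs => hs.2
      exact ⟨i, by omega, h⟩
    · exact ⟨n, by omega, h⟩

end Positive

namespace LadderSystem

variable (L : LadderSystem)

theorem nil_mem_S {α : Ordinal.{0}} : [] ∈ L.S α ↔ α = 0 := Iff.rfl

theorem sectionAt_subset_S {α : Ordinal.{0}} {X : Set (List ℕ)} (hX : X ⊆ L.S α) (n : ℕ) :
    sectionAt X [n] ⊆ L.S (L.seq α n) := fun _ hs => (hX hs).2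

theorem nil_notMem {α : Ordinal.{0}} (hα : 0 < α) {X : Set (List ℕ)} (hX : X ⊆ L.S α) :
    [] ∉ X := fun h => hα.ne' (hX h)

theorem positive_iff_of_subset_zero {Y : Set (List ℕ)} (hY : Y ⊆ L.S 0) :
    Positive Y ↔ [] ∈ Y := by
  refine ⟨fun h => ?_, .leaf⟩
  cases h with
  | leaf h => exact h
  | node M hM h =>
    obtain ⟨k, hk⟩ := hM.nonempty
    obtain ⟨s, hs⟩ := (h k hk).nonempty
    exact absurd (hY hs).1 (lt_irrefl _)

/-- This replaces recursion on `α` by structural induction. It fails at `α = 0`, where `finIdeal`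
contains every subset of `S 0`; hence `α = 1` is the base case, in which the sections are positive
exactly when they contain `[]`. -/
theorem notMem_finIdeal_iff {α : Ordinal.{0}} (h0 : 0 < α) (h1 : α < ω₁) {Y : Set (List ℕ)}
    (hY : Y ⊆ L.S α) : Y ∉ L.finIdeal α ↔ Positive Y := by
  induction α using WellFoundedLT.induction generalizing Y with
  | ind α ih =>
  have hnil := L.nil_notMem h0 hY
  have key : Positive Y ↔ {k | Positive (sectionAt Y [k])}.Infinite :=
    ⟨fun h => h.infinite_of_nil_notMem hnil, fun h => .node _ h fun _ hk => hk⟩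
  rcases (Order.one_le_iff_pos.2 h0).eq_or_lt with h | h
  · subst h
    rw [mem_finIdeal_one, key]
    have hseq : ∀ k, L.seq 1 k = 0 := fun k => by
      have := L.seq_lt h0 h1 k
      rwa [Order.lt_one_iff] at this
    have hpos : ∀ k, Positive (sectionAt Y [k]) ↔ [k] ∈ Y := fun k => by
      have := L.sectionAt_subset_S hY k
      rw [hseq] at this
      exact L.positive_iff_of_subset_zero this
    simp only [hpos, hY, true_and]
    have himage : Y = (fun k => [k]) '' {k | [k] ∈ Y} := by
      ext s
      constructor
      · intro hs
        rcases s with _ | ⟨k, _ | ⟨j, s⟩⟩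
        · exact absurd hs hnil
        · exact ⟨k, hs, rfl⟩
        · have := (hY hs).2
          rw [hseq] at this
          exact absurd this.1 (lt_irrefl _)
      · rintro ⟨k, hk, rfl⟩
        exact hk
    have hinj : Function.Injective (fun k : ℕ => [k]) := fun a b h => by simpa using h
    constructor
    · intro hinf hfin
      exact hinf (himage ▸ hfin.image _)
    · intro hinf hfin
      rw [himage] at hfin
      exact hinf (hfin.of_finite_image hinj.injOn)
  · rw [L.mem_finIdeal_of_one_lt h h1, key]
    simp only [hY, true_and]
    have : {n | sectionAt Y [n] ∉ L.finIdeal (L.seq α n)} = {k | Positive (sectionAt Y [k])} := by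
      ext n
      exact ih _ (L.seq_lt h0 h1 n) (L.seq_pos α h h1 n) ((L.seq_lt h0 h1 n).trans h1)
        (L.sectionAt_subset_S hY n)
    rw [this]
    rfl

end LadderSystem

/-! ### Fronts and positivity along index sets -/

/-- Well-founded trees, given by their leaves, with infinite branching at all other nodes. -/
inductive FullFront : Set (List ℕ) → Prop
  | leaf : FullFront {[]}
  | node {X : Set (List ℕ)} : [] ∉ X → (succs X).Infinite →
      (∀ k ∈ succs X, FullFront (sectionAt X [k])) → FullFront X

namespace FullFront

theorem nonempty {X : Set (List ℕ)} (h : FullFront X) : X.Nonempty := by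
  cases h with
  | leaf => exact ⟨[], rfl⟩
  | node _ h _ =>
    obtain ⟨k, s, hs⟩ := h.nonempty
    exact ⟨_, hs⟩

theorem eq_singleton {X : Set (List ℕ)} (h : FullFront X) (h0 : [] ∈ X) : X = {[]} := by
  cases h with
  | leaf => rfl
  | node h _ _ => exact absurd h0 h

theorem succs_infinite {X : Set (List ℕ)} (h : FullFront X) (h0 : [] ∉ X) :
    (succs X).Infinite := by
  cases h with
  | leaf => exact absurd rfl h0
  | node _ h _ => exact h

theorem of_mem_succs {X : Set (List ℕ)} (h : FullFront X) {k : ℕ} (hk : k ∈ succs X) :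
    FullFront (sectionAt X [k]) := by
  cases h with
  | leaf =>
    obtain ⟨s, hs⟩ := hk
    simp at hs
  | node _ _ h => exact h k hk

theorem of_child {X : Set (List ℕ)} (h : FullFront X) (h0 : [] ∉ X) (m : ℕ) :
    FullFront (sectionAt X [child X m]) := h.of_mem_succs (child_mem (h.succs_infinite h0) m)

theorem of_nonempty {X : Set (List ℕ)} (h : FullFront X) (t : List ℕ)
    (ht : (sectionAt X t).Nonempty) : FullFront (sectionAt X t) := by
  induction t generalizing X with
  | nil => exact h
  | cons k t ih =>
    have heq : sectionAt X (k :: t) = sectionAt (sectionAt X [k]) t := by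
      rw [sectionAt_sectionAt]; rfl
    rw [heq] at ht ⊢
    obtain ⟨r, hr⟩ := ht
    exact ih (h.of_mem_succs ⟨t ++ r, hr⟩) ⟨r, hr⟩

end FullFront

theorem mem_higherDom_iff {X : Set (List ℕ)} {t : List ℕ} :
    t ∈ higherDom X ↔ ∃ r, r ≠ [] ∧ t ++ r ∈ X := by
  constructor
  · rintro ⟨s, hs, k, hk, rfl⟩
    refine ⟨s.drop k, ?_, by rwa [List.take_append_drop]⟩
    simpa using hk
  · rintro ⟨r, hr, h⟩
    refine ⟨_, h, t.length, ?_, by simp⟩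
    simpa [List.length_pos_iff] using hr

theorem fullFront_of_subset_S (L : LadderSystem) {α : Ordinal.{0}} (h1 : α < ω₁)
    {X : Set (List ℕ)} (hX : X ⊆ L.S α) (hne : X.Nonempty)
    (h : ∀ s ∈ higherDom X, {n : ℕ | s ++ [n] ∈ higherDom X ∪ X}.Infinite) : FullFront X := by
  induction α using WellFoundedLT.induction generalizing X with
  | ind α ih =>
  rcases eq_or_ne α 0 with rfl | h0
  · have hs : ∀ s ∈ X, s = [] := fun s hs => by
      rcases s with _ | ⟨n, s⟩
      · rfl
      · exact absurd (hX hs).1 (lt_irrefl _)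
    rw [hne.subset_singleton_iff.1 hs]
    exact .leaf
  have hpos : 0 < α := pos_iff_ne_zero.2 h0
  have hnil := L.nil_notMem hpos hX
  refine .node hnil ?_ fun k hk => ?_
  · obtain ⟨s, hs⟩ := hne
    refine (h [] (mem_higherDom_iff.2 ⟨s, fun h => hnil (h ▸ hs), hs⟩)).mono ?_
    rintro n (hn | hn)
    · obtain ⟨r, _, hr⟩ := mem_higherDom_iff.1 hn
      exact ⟨r, hr⟩
    · exact ⟨[], hn⟩
  · refine ih _ (L.seq_lt hpos h1 k) ((L.seq_lt hpos h1 k).trans h1) (L.sectionAt_subset_S hX k)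
      hk fun s hs => ?_
    obtain ⟨r, hr, hsr⟩ := mem_higherDom_iff.1 hs
    refine (h (k :: s) (mem_higherDom_iff.2 ⟨r, hr, hsr⟩)).mono ?_
    rintro n (hn | hn)
    · obtain ⟨r, hr, hsr⟩ := mem_higherDom_iff.1 hn
      exact Or.inl (mem_higherDom_iff.2 ⟨r, hr, hsr⟩)
    · exact Or.inr hn

theorem LadderSystem.fullFront_of_mem_finPosPos (L : LadderSystem) {α : Ordinal.{0}} (h0 : 0 < α)
    (h1 : α < ω₁) {X : Set (List ℕ)} (hX : X ∈ L.finPosPos α) : FullFront X :=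
  fullFront_of_subset_S L h1 hX.1.1 ((L.notMem_finIdeal_iff h0 h1 hX.1.1).1 hX.1.2).nonempty hX.2

/-- The set `Y` is positive in the front `X` along the elements of `X` with indices in `D`. -/
inductive PosAlong (D : Set ℕ) : Set (List ℕ) → Set (List ℕ) → Prop
  | leaf {X Y : Set (List ℕ)} : [] ∈ X → [] ∈ Y → PosAlong D X Y
  | node {X Y : Set (List ℕ)} (M : Set ℕ) : [] ∉ X → M.Infinite → M ⊆ D →
      (∀ m ∈ M, PosAlong D (sectionAt X [child X m]) (sectionAt Y [child X m])) → PosAlong D X Y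

namespace PosAlong

theorem nonempty {D : Set ℕ} {X Y : Set (List ℕ)} (h : PosAlong D X Y) : X.Nonempty := by
  induction h with
  | leaf h _ => exact ⟨_, h⟩
  | node M _ hM _ _ ih =>
    obtain ⟨m, hm⟩ := hM.nonempty
    obtain ⟨s, hs⟩ := ih m hm
    exact ⟨_, hs⟩

theorem nil_mem {D : Set ℕ} {X Y : Set (List ℕ)} (h : PosAlong D X Y) (h0 : [] ∈ X) : [] ∈ Y := by
  cases h with
  | leaf _ h => exact h
  | node _ h _ _ _ => exact absurd h0 h

theorem infinite {D : Set ℕ} {X Y : Set (List ℕ)} (h : PosAlong D X Y) (h0 : [] ∉ X) :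
    {m ∈ D | PosAlong D (sectionAt X [child X m]) (sectionAt Y [child X m])}.Infinite := by
  cases h with
  | leaf h _ => exact absurd h h0
  | node M _ hM hMD h => exact hM.mono fun m hm => ⟨hMD hm, h m hm⟩

theorem of_sdiff_finite {D D' : Set ℕ} (hD : (D \ D').Finite) {X Y : Set (List ℕ)}
    (h : PosAlong D X Y) : PosAlong D' X Y := by
  induction h with
  | leaf h h' => exact .leaf h h'
  | node M h0 hM hMD _ ih =>
    refine .node (M ∩ D') h0 ?_ inter_subset_right fun m hm => ih m hm.1
    have : M = (M ∩ D') ∪ (M \ D') := (inter_union_sdiff M D').symm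
    rw [this] at hM
    exact (infinite_union.1 hM).resolve_right fun h => h (hD.subset (sdiff_subset_sdiff_left hMD))

theorem positive {D : Set ℕ} {X Y : Set (List ℕ)} (h : PosAlong D X Y) (hX : FullFront X) :
    Positive (X ∩ Y) := by
  induction h with
  | leaf h h' => exact .leaf ⟨h, h'⟩
  | @node X Y M h0 hM _ _ ih =>
    have hinj := (child_strictMono (hX.succs_infinite h0)).injective
    refine .node (child X '' M) (hM.image hinj.injOn) ?_
    rintro _ ⟨m, hm, rfl⟩
    exact ih m hm (hX.of_child h0 m)

end PosAlong

/-! ### Index paths and the hat map -/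

/-- The graph of the map sending a sequence of indices to the corresponding path through `X`. -/
def PathGraph : Set (List ℕ) → List ℕ → List ℕ → Prop
  | _, [], t => t = []
  | _, _ :: _, [] => False
  | X, m :: s, k :: t => child X m = k ∧ PathGraph (sectionAt X [k]) s t

theorem pathGraph_of_forall {X : Set (List ℕ)} {s t : List ℕ} (hl : t.length = s.length)
    (h : ∀ (n : ℕ) (hn : n < s.length),
      IsEnum {k | ∃ s', t.take n ++ k :: s' ∈ X} (s[n]) (t[n]'(hl ▸ hn))) : PathGraph X s t := by
  induction s generalizing X t with
  | nil => exact List.length_eq_zero_iff.1 hl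
  | cons m s ih =>
    rcases t with _ | ⟨k, t⟩
    · simp at hl
    · refine ⟨(h 0 (by simp)).2, ih (by simpa using hl) fun n hn => ?_⟩
      exact h (n + 1) (by simpa using hn)

theorem forall_of_pathGraph {X : Set (List ℕ)} (hX : FullFront X) {s t : List ℕ}
    (h : PathGraph X s t) (ht : t ∈ X) : ∃ hl : t.length = s.length,
      ∀ (n : ℕ) (hn : n < s.length),
        IsEnum {k | ∃ s', t.take n ++ k :: s' ∈ X} (s[n]) (t[n]'(hl ▸ hn)) := by
  induction s generalizing X t with
  | nil =>
    obtain rfl : t = [] := h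
    exact ⟨rfl, fun n hn => by simp at hn⟩
  | cons m s ih =>
    rcases t with _ | ⟨k, t⟩
    · exact h.elim
    · obtain ⟨hk, hs⟩ := h
      have h0 : [] ∉ X := fun h0 => by
        rw [hX.eq_singleton h0] at ht
        simp at ht
      obtain ⟨hl, hs⟩ := ih (hX.of_mem_succs ⟨t, ht⟩) hs ht
      refine ⟨by simp [hl], fun n hn => ?_⟩
      rcases n with _ | n
      · exact ⟨fun hf => absurd hf (hX.succs_infinite h0), hk⟩
      · exact hs n (by simpa using hn)

/-- The hat map only asks for `t ∈ S α`. No element of `S α` is a proper initial segment of another,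
so a path through `X` that ends in `S α` ends at a leaf of `X`. -/
theorem LadderSystem.mem_of_pathGraph (L : LadderSystem) {α : Ordinal.{0}} {X : Set (List ℕ)}
    (hX : FullFront X) (hXS : X ⊆ L.S α) {s t : List ℕ} (h : PathGraph X s t) (ht : t ∈ L.S α) :
    t ∈ X := by
  induction t generalizing α X s with
  | nil =>
    obtain ⟨r, hr⟩ := hX.nonempty
    rcases r with _ | ⟨k, r⟩
    · exact hr
    · exact absurd (L.nil_mem_S.1 ht) (hXS hr).1.ne'
  | cons k t ih =>
    rcases s with _ | ⟨m, s⟩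
    · simp [PathGraph] at h
    · have h0 := L.nil_notMem ht.1 hXS
      obtain ⟨rfl, h⟩ := h
      exact ih (hX.of_child h0 m) (L.sectionAt_subset_S hXS _) h ht.2

/-- Every element of `Z` is reached by indices from `C`, so each branching of `Z` is a branching of
`X` whose indices lie in `C`. -/
theorem Positive.posAlong {C : Set ℕ} {X Y Z : Set (List ℕ)} (h : Positive Z) (hX : FullFront X)
    (hZ : ∀ t ∈ Z, t ∈ Y ∧ t ∈ X ∧ ∃ s : List ℕ, (∀ i ∈ s, i ∈ C) ∧ PathGraph X s t) :
    PosAlong C X Y := by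
  induction h generalizing X Y with
  | leaf h => exact .leaf (hZ _ h).2.1 (hZ _ h).1
  | @node Z M hM hpos ih =>
    have hmem : ∀ k ∈ M, k ∈ succs X := fun k hk => by
      obtain ⟨t, ht⟩ := (hpos k hk).nonempty
      exact ⟨t, (hZ _ ht).2.1⟩
    have h0 : [] ∉ X := fun h0 => by
      obtain ⟨k, hk⟩ := hM.nonempty
      obtain ⟨t, ht⟩ := hmem k hk
      rw [hX.eq_singleton h0] at ht
      simp at ht
    have hk : ∀ k ∈ M, ∃ m ∈ C, child X m = k := fun k hk => by
      obtain ⟨t, ht⟩ := (hpos k hk).nonempty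
      obtain ⟨_, _, s, hs, hst⟩ := hZ _ ht
      rcases s with _ | ⟨m, s⟩
      · simp [PathGraph] at hst
      · exact ⟨m, hs m (by simp), hst.1⟩
    have hinj := (child_strictMono (hX.succs_infinite h0)).injective
    refine .node {m ∈ C | child X m ∈ M} h0 ?_ (fun m hm => hm.1) fun m hm => ?_
    · intro hfin
      refine hM ((hfin.image (child X)).subset fun k hkM => ?_)
      obtain ⟨m, hm, rfl⟩ := hk k hkM
      exact ⟨m, ⟨hm, hkM⟩, rfl⟩
    · refine ih _ hm.2 (hX.of_child h0 m) fun t ht => ?_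
      obtain ⟨hY, hXt, s, hs, hst⟩ := hZ _ ht
      refine ⟨hY, hXt, ?_⟩
      rcases s with _ | ⟨m', s⟩
      · simp [PathGraph] at hst
      · exact ⟨s, fun i hi => hs i (by simp [hi]), hst.2⟩

theorem FullFront.positive_increasing {X : Set (List ℕ)} (hX : FullFront X) {C : Set ℕ}
    (hC : C.Infinite) (N : ℕ) :
    Positive {t ∈ X | ∃ s : List ℕ, s.Pairwise (· < ·) ∧ (∀ i ∈ s, i ∈ C ∧ N < i) ∧
      PathGraph X s t} := by
  induction hX generalizing N with
  | leaf => exact .leaf ⟨rfl, [], .nil, by simp, rfl⟩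
  | @node X h0 hinf hX ih =>
    have hinj := (child_strictMono hinf).injective
    have hCN : (C ∩ Ioi N).Infinite := infinite_of_forall_exists_gt fun a => by
      obtain ⟨m, hm, hlt⟩ := hC.exists_gt (a + N)
      exact ⟨m, ⟨hm, show N < m by omega⟩, by omega⟩
    refine .node (child X '' (C ∩ Ioi N)) (hCN.image hinj.injOn) ?_
    rintro _ ⟨m, ⟨hmC, hmN⟩, rfl⟩
    refine (ih _ (child_mem hinf m) m).mono ?_
    rintro t ⟨ht, s, hs, hsC, hst⟩
    have hmN' : N < m := hmN
    refine ⟨ht, m :: s, List.pairwise_cons.2 ⟨fun i hi => (hsC i hi).2, hs⟩, ?_, rfl, hst⟩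
    intro i hi
    rcases List.mem_cons.1 hi with rfl | hi
    · exact ⟨hmC, hmN⟩
    · exact ⟨(hsC i hi).1, hmN'.trans (hsC i hi).2⟩

/-! ### Consecutive pairs and the tilde image -/

theorem Consec.unique {C : Set ℕ} {l m m' : ℕ} (h : Consec C l m) (h' : Consec C l m') : m = m' :=
  h.2.unique h'.2

theorem Consec.lt {C : Set ℕ} {l m : ℕ} (h : Consec C l m) : l < m := h.2.1.2

theorem Consec.mem_right {C : Set ℕ} {l m : ℕ} (h : Consec C l m) : m ∈ C := h.2.1.1

theorem exists_consec {C : Set ℕ} (hC : C.Infinite) {l : ℕ} (hl : l ∈ C) : ∃ m, Consec C l m := by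
  obtain ⟨m, hm, hlt⟩ := hC.exists_gt l
  have hne : {k | k ∈ C ∧ l < k}.Nonempty := ⟨m, hm, hlt⟩
  exact ⟨sInf {k | k ∈ C ∧ l < k}, hl, Nat.sInf_mem hne, fun k hk => Nat.sInf_le hk⟩

theorem Consec.inter_Ioi {C : Set ℕ} {l m N : ℕ} (h : Consec C l m) (hl : N < l) :
    Consec (C ∩ Ioi N) l m :=
  ⟨⟨h.1, hl⟩, ⟨⟨h.mem_right, hl.trans h.lt⟩, h.lt⟩, fun _ hk => h.2.2 ⟨hk.1.1, hk.2⟩⟩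

/-- The node `u.2` of the tree of initial segments of `x u.1` is positive for `A` along `D`. -/
def NodePos (x : ℕ → Set (List ℕ)) (D : Set ℕ) (A : Set (List ℕ)) (u : ℕ × List ℕ) : Prop :=
  PosAlong D (sectionAt (x u.1) u.2) (sectionAt A u.2)

/-- The node of length one in `x l` with index `m`. -/
noncomputable def pairNode (x : ℕ → Set (List ℕ)) (l m : ℕ) : ℕ × List ℕ := (l, [child (x l) m])

/-- The immediate successor with index `m` of the node `u`. -/
noncomputable def childNode (x : ℕ → Set (List ℕ)) (u : ℕ × List ℕ) (m : ℕ) : ℕ × List ℕ :=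
  (u.1, u.2 ++ [child (sectionAt (x u.1) u.2) m])

theorem nodePos_childNode_iff {x : ℕ → Set (List ℕ)} {D : Set ℕ} {A : Set (List ℕ)}
    {u : ℕ × List ℕ} {m : ℕ} : NodePos x D A (childNode x u m) ↔
      PosAlong D (sectionAt (sectionAt (x u.1) u.2) [child (sectionAt (x u.1) u.2) m])
        (sectionAt (sectionAt A u.2) [child (sectionAt (x u.1) u.2) m]) := by
  rw [sectionAt_sectionAt, sectionAt_sectionAt]; rfl

namespace LadderSystem

variable (L : LadderSystem)

theorem tilde_subset_S {α : Ordinal.{0}} (x : ℕ → Set (List ℕ)) (C : Set ℕ) :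
    L.tilde α x C ⊆ L.S α := by
  rintro t ⟨l, a, ha, _, _, _, h⟩
  exact h.1

theorem positive_tilde {α : Ordinal.{0}} (h0 : 0 < α) {x : ℕ → Set (List ℕ)}
    (hx : ∀ l, FullFront (x l)) (hxS : ∀ l, x l ⊆ L.S α) {C : Set ℕ} (hC : C.Infinite) :
    Positive (L.tilde α x C) := by
  have hnil := fun l => L.nil_notMem h0 (hxS l)
  have hinf := fun l => (hx l).succs_infinite (hnil l)
  refine .node {k | ∃ l m, Consec C l m ∧ child (x l) m = k} ?_ ?_
  · refine infinite_of_forall_exists_gt fun a => ?_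
    obtain ⟨l, hl, hla⟩ := hC.exists_gt a
    obtain ⟨m, hm⟩ := exists_consec hC hl
    exact ⟨_, ⟨l, m, hm, rfl⟩, (hla.trans hm.lt).trans_le ((child_strictMono (hinf l)).id_le m)⟩
  · rintro _ ⟨l, m, hlm, rfl⟩
    -- The lower bound `m` makes `m :: s` increasing, hence the enumeration of its own underlying
    -- finite set.
    refine (((hx l).of_child (hnil l) m).positive_increasing hC m).mono ?_
    rintro t ⟨ht, s, hs, hsC, hst⟩
    have hpair : (m :: s).Pairwise (· < ·) := List.pairwise_cons.2 ⟨fun i hi => (hsC i hi).2, hs⟩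
    have hne : (m :: s).toFinset.Nonempty := ⟨m, by simp⟩
    have hmin : (m :: s).toFinset.min' hne = m := by
      refine le_antisymm (Finset.min'_le _ _ (by simp)) (Finset.le_min' _ _ _ fun i hi => ?_)
      rcases List.mem_cons.1 (List.mem_toFinset.1 hi) with rfl | hi
      · exact le_rfl
      · exact (hsC i hi).2.le
    have hsort : (m :: s).toFinset.sort (· ≤ ·) = m :: s :=
      (List.toFinset_sort (· ≤ ·) (hpair.imp ne_of_lt)).2 (hpair.imp le_of_lt)
    refine ⟨l, (m :: s).toFinset, hne, hlm.1, ?_, by rwa [hmin], hxS l ht, ?_⟩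
    · intro i hi
      rcases List.mem_cons.1 (List.mem_toFinset.1 hi) with rfl | hi
      · exact hlm.mem_right
      · exact (hsC i hi).1
    · rw [hsort]
      exact forall_of_pathGraph (hx l) ⟨rfl, hst⟩ ht

/-- A first coordinate `k` of the tilde image comes from consecutive `l < m` with `m ≤ child (x l) m
= k`. So only finitely many `l` contribute to the section at `k`, and one contribution is positive.
-/
theorem exists_consec_nodePos {α : Ordinal.{0}} (h0 : 0 < α) {x : ℕ → Set (List ℕ)}
    (hx : ∀ l, FullFront (x l)) (hxS : ∀ l, x l ⊆ L.S α) {C : Set ℕ} {A : Set (List ℕ)}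
    (h : Positive (L.tilde α x C ∩ A)) (N : ℕ) :
    ∃ l m, N < l ∧ Consec C l m ∧ NodePos x C A (pairNode x l m) := by
  have hnil := fun l => L.nil_notMem h0 (hxS l)
  have hinf := fun l => (hx l).succs_infinite (hnil l)
  have hM := h.infinite_of_nil_notMem (L.nil_notMem h0
    (inter_subset_left.trans (L.tilde_subset_S x C)))
  -- Each `l ≤ N` has at most one successor in `C`, so it produces at most one first coordinate;
  -- avoiding these forces `N < l`.
  have hbad : (⋃ l ∈ Iic N, {k | ∃ m, Consec C l m ∧ child (x l) m = k}).Finite :=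
    (finite_Iic N).biUnion fun l _ => Set.Subsingleton.finite (by
      rintro _ ⟨m, hm, rfl⟩ _ ⟨m', hm', rfl⟩
      rw [hm.unique hm'])
  obtain ⟨k, hk, hkbad⟩ := hM.exists_notMem_finite hbad
  obtain ⟨l, _, hl⟩ := Positive.exists_of_biUnion (fun l => {t | ∃ m, Consec C l m ∧
      child (x l) m = k ∧ t ∈ sectionAt A [k] ∧ t ∈ sectionAt (x l) [k] ∧
      ∃ s : List ℕ, (∀ i ∈ s, i ∈ C) ∧ PathGraph (sectionAt (x l) [k]) s t}) k hk (by
    rintro t ⟨⟨l, a, ha, hl, haC, hcons, htS, hlen, hgraph⟩, htA⟩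
    have hpath := pathGraph_of_forall hlen hgraph
    have htx := L.mem_of_pathGraph (hx l) (hxS l) hpath htS
    have hsC : ∀ i ∈ a.sort (· ≤ ·), i ∈ C := fun i hi => haC ((Finset.mem_sort _).1 hi)
    have hhead : ∀ m s, a.sort (· ≤ ·) = m :: s → a.min' ha = m := fun m s hms => by
      have hsorted : (m :: s).Pairwise (· ≤ ·) := hms ▸ a.pairwise_sort (· ≤ ·)
      refine le_antisymm (Finset.min'_le _ _ ((Finset.mem_sort (· ≤ ·)).1 (by simp [hms])))
        (Finset.le_min' _ _ _ fun i hi => ?_)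
      rw [← Finset.mem_sort (· ≤ ·), hms] at hi
      rcases List.mem_cons.1 hi with rfl | hi
      · exact le_rfl
      · exact (List.pairwise_cons.1 hsorted).1 i hi
    generalize a.sort (· ≤ ·) = r at hpath hsC hhead
    rcases r with _ | ⟨m, s⟩
    · simp [PathGraph] at hpath
    · rw [hhead m s rfl] at hcons
      obtain ⟨hk, hpath⟩ := hpath
      refine ⟨l, ?_, m, hcons, hk, htA, htx, s, fun i hi => hsC i (by simp [hi]), hpath⟩
      exact hcons.lt.trans_le (((child_strictMono (hinf l)).id_le m).trans hk.le))
  obtain ⟨_, m, hm, hmk, _⟩ := hl.nonempty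
  refine ⟨l, m, ?_, hm, ?_⟩
  · by_contra hlN
    exact hkbad (mem_biUnion (show l ∈ Iic N from not_lt.1 hlN) ⟨m, hm, hmk⟩)
  · subst hmk
    refine hl.posAlong ((hx l).of_child (hnil l) m) ?_
    rintro t ⟨_, _, _, h⟩
    exact h

end LadderSystem

/-! ### Codes in Baire space -/

/-- The sequence `y` extends the finite sequence `t`. -/
def Extends (y : ℕ → ℕ) (t : List ℕ) : Prop := ∀ i v, t[i]? = some v → y i = v

theorem Extends.concat {y : ℕ → ℕ} {t : List ℕ} (h : Extends y t) :
    Extends y (t ++ [y t.length]) := by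
  intro i v hv
  rcases lt_trichotomy i t.length with hi | rfl | hi
  · rw [List.getElem?_append_left hi] at hv
    exact h i v hv
  · simpa using hv
  · rw [List.getElem?_eq_none (by simp; omega)] at hv
    simp at hv

theorem extends_ofFn (y : ℕ → ℕ) (n : ℕ) : Extends y ((List.range n).map y) := by
  intro i v hv
  obtain ⟨hi, hv⟩ := List.getElem?_eq_some_iff.1 hv
  simpa using hv

theorem Extends.agree {y z : ℕ → ℕ} {t : List ℕ} (hy : Extends y t) (hz : Extends z t) {i : ℕ}
    (hi : i < t.length) : z i = y i := by
  have := List.getElem?_eq_getElem hi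
  rw [hy i _ this, hz i _ this]

theorem exists_extends_of_chain (t : ℕ → List ℕ) (ht : ∀ n, t n <+: t (n + 1))
    (hlen : ∀ N, ∃ n, N ≤ (t n).length) : ∃ y, ∀ n, Extends y (t n) := by
  have hmono : ∀ m n, m ≤ n → t m <+: t n := fun m n hmn => by
    induction n, hmn using Nat.le_induction with
    | base => exact List.prefix_rfl
    | succ n _ ih => exact ih.trans (ht n)
  choose k hk using fun i => hlen (i + 1)
  refine ⟨fun i => (t (k i))[i]'(hk i), fun n i v hv => ?_⟩
  obtain ⟨hi, hv⟩ := List.getElem?_eq_some_iff.1 hv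
  rcases le_total n (k i) with h | h
  · rw [← hv]
    exact ((hmono _ _ h).getElem hi).symm
  · rw [← hv]
    exact (hmono _ _ h).getElem (hk i)

/-- Every coordinate of `φ y` is decided by a finite initial segment of `y`. -/
def LocallyDecided (φ : (ℕ → ℕ) → Set (List ℕ)) : Prop :=
  ∀ y v, ∃ n : ℕ, ∀ z : ℕ → ℕ, (∀ i < n, z i = y i) → (v ∈ φ z ↔ v ∈ φ y)

theorem locallyDecided_of_continuous {f : (ℕ → ℕ) → List ℕ → Bool} (hf : Continuous f) :
    LocallyDecided fun y => {s | f y s = true} := by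
  intro y v
  have hopen : IsOpen {z | f z v = f y v} :=
    (isOpen_discrete {f y v}).preimage ((continuous_apply v).comp hf)
  obtain ⟨_, ⟨u, n, rfl⟩, hyu, hn⟩ :=
    (PiNat.isTopologicalBasis_cylinders (fun _ => ℕ)).mem_nhds_iff.1 (hopen.mem_nhds rfl)
  refine ⟨n, fun z hz => ?_⟩
  have hz : f z v = f y v := hn fun i hi => (hz i hi).trans (hyu i hi)
  simp [hz]

theorem IsAnalyticFamily.exists_locallyDecided {𝒜 : Set (Set (List ℕ))}
    (h : IsAnalyticFamily 𝒜) (hne : 𝒜.Nonempty) :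
    ∃ φ : (ℕ → ℕ) → Set (List ℕ), LocallyDecided φ ∧ range φ = 𝒜 := by
  classical
  have hmem : ∀ A ∈ 𝒜, (fun s => decide (s ∈ A)) ∈ {f : List ℕ → Bool | {s | f s = true} ∈ 𝒜} :=
    fun A hA => by simpa using hA
  rw [IsAnalyticFamily, MeasureTheory.AnalyticSet] at h
  rcases h with h | ⟨f, hf, hrange⟩
  · obtain ⟨A, hA⟩ := hne
    have := hmem A hA
    rw [h] at this
    exact this.elim
  · refine ⟨_, locallyDecided_of_continuous hf, ?_⟩
    ext A
    constructor
    · rintro ⟨y, rfl⟩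
      have : f y ∈ range f := mem_range_self y
      rwa [hrange] at this
    · intro hA
      have := hmem A hA
      rw [← hrange] at this
      obtain ⟨y, hy⟩ := this
      exact ⟨y, by simp [hy]⟩

/-! ### Conditions and their largeness -/

/-- `A` meets the tilde image of `D` positively, and all the nodes in `F` are positive for `A`. -/
def Catches (x : ℕ → Set (List ℕ)) (D : Set ℕ) (A : Set (List ℕ))
    (F : Finset (ℕ × List ℕ)) : Prop :=
  (∀ N, ∃ l m, N < l ∧ Consec D l m ∧ NodePos x D A (pairNode x l m)) ∧ ∀ u ∈ F, NodePos x D A u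

/-- No set `φ y` with `y` extending `t` catches, on an infinite subset of `C`, all the nodes
in `F`. -/
def NeverCaught (x : ℕ → Set (List ℕ)) (φ : (ℕ → ℕ) → Set (List ℕ)) (t : List ℕ)
    (F : Finset (ℕ × List ℕ)) (C : Set ℕ) : Prop :=
  ∀ D ⊆ C, D.Infinite → ∀ y, Extends y t → ¬ Catches x D (φ y) F

theorem infinite_inter_Ioi {D : Set ℕ} (hD : D.Infinite) (N : ℕ) : (D ∩ Ioi N).Infinite :=
  infinite_of_forall_exists_gt fun a => by
    obtain ⟨m, hm, hlt⟩ := hD.exists_gt (a + N)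
    exact ⟨m, ⟨hm, show N < m by omega⟩, by omega⟩

theorem sdiff_inter_Ioi_finite (D : Set ℕ) (N : ℕ) : (D \ (D ∩ Ioi N)).Finite :=
  (finite_Iic N).subset fun m hm => by
    by_contra h
    exact hm.2 ⟨hm.1, show N < m from not_le.1 h⟩

section

variable {x : ℕ → Set (List ℕ)} {φ : (ℕ → ℕ) → Set (List ℕ)}

/-- Consecutive pairs beyond `N` stay consecutive, and positivity along `D` ignores finite changes
of `D`. This makes largeness invariant under removing initial parts, as the fusion argument needs.
-/
theorem Catches.inter_Ioi {D : Set ℕ} {A : Set (List ℕ)} {F : Finset (ℕ × List ℕ)}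
    (h : Catches x D A F) (N : ℕ) : Catches x (D ∩ Ioi N) A F := by
  refine ⟨fun N' => ?_, fun u hu => (h.2 u hu).of_sdiff_finite (sdiff_inter_Ioi_finite D N)⟩
  obtain ⟨l, m, hl, hlm, hpos⟩ := h.1 (N' + N)
  exact ⟨l, m, by omega, hlm.inter_Ioi (by omega),
    hpos.of_sdiff_finite (sdiff_inter_Ioi_finite D N)⟩

theorem Catches.insert {D : Set ℕ} {A : Set (List ℕ)} {F : Finset (ℕ × List ℕ)}
    (h : Catches x D A F) {u : ℕ × List ℕ} (hu : NodePos x D A u) :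
    Catches x D A (insert u F) := by
  refine ⟨h.1, fun v hv => ?_⟩
  rcases Finset.mem_insert.1 hv with rfl | hv
  · exact hu
  · exact h.2 v hv

theorem NeverCaught.of_inter_Ioi {t : List ℕ} {F : Finset (ℕ × List ℕ)} {C : Set ℕ} {N : ℕ}
    (h : NeverCaught x φ t F (C ∩ Ioi N)) : NeverCaught x φ t F C := fun D hDC hD y hy hcatch =>
  h (D ∩ Ioi N) (inter_subset_inter_left _ hDC) (infinite_inter_Ioi hD N) y hy (hcatch.inter_Ioi N)

theorem NeverCaught.subset {t : List ℕ} {F : Finset (ℕ × List ℕ)} {C C' : Set ℕ}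
    (h : NeverCaught x φ t F C) (hC : C' ⊆ C) : NeverCaught x φ t F C' :=
  fun D hD => h D (hD.trans hC)

/-- Every infinite set has an infinite subset on which smallness is decided for all finite
conditions, hereditarily. -/
theorem exists_forall_neverCaught (x : ℕ → Set (List ℕ)) (φ : (ℕ → ℕ) → Set (List ℕ))
    {W : Set ℕ} (hW : W.Infinite) : ∃ B ⊆ W, B.Infinite ∧ ∀ t F, ∀ C ⊆ B, C.Infinite →
      NeverCaught x φ t F C → NeverCaught x φ t F B := by
  obtain ⟨B, hBW, hB, h⟩ := exists_mem_forall_of_dense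
    (fun p : List ℕ × Finset (ℕ × List ℕ) => {C : Set ℕ | NeverCaught x φ p.1 p.2 C ∨
      ∀ C' ⊆ C, C'.Infinite → ¬ NeverCaught x φ p.1 p.2 C'}) W hW
    (fun p C _ hC => by
      by_cases h : ∃ C' ⊆ C, C'.Infinite ∧ NeverCaught x φ p.1 p.2 C'
      · obtain ⟨C', h1, h2, h3⟩ := h
        exact ⟨C', h1, h2, Or.inl h3⟩
      · exact ⟨C, Subset.rfl, hC, Or.inr fun C' h1 h2 h3 => h ⟨C', h1, h2, h3⟩⟩)
    (fun p C hC C' hC' => hC.imp (fun h => h.subset hC') fun h D hD => h D (hD.trans hC'))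
    (fun p N C hC => hC.imp (fun h => h.of_inter_Ioi) fun h D hD hDi hs =>
      h (D ∩ Ioi N) (inter_subset_inter_left _ hD) (infinite_inter_Ioi hDi N)
        (hs.subset inter_subset_left))
  refine ⟨B, hBW, hB, fun t F C hC hCi hs => (h (t, F)).resolve_right fun h => h C hC hCi hs⟩

/-- Thinning out an infinite set makes countably many subsets of `ℕ` trivial on it. -/
theorem exists_forall_almost_subset {ι : Type*} [Countable ι] (G : ι → Set ℕ) {B : Set ℕ}
    (hB : B.Infinite) : ∃ C ⊆ B, C.Infinite ∧
      ∀ i, ∃ N, (∀ m ∈ C, N < m → m ∈ G i) ∨ ∀ m ∈ C, N < m → m ∉ G i := by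
  refine exists_mem_forall_of_dense
    (fun i => {C | ∃ N, (∀ m ∈ C, N < m → m ∈ G i) ∨ ∀ m ∈ C, N < m → m ∉ G i}) B hB ?_ ?_ ?_
  · intro i C _ hC
    rw [← inter_union_sdiff C (G i), infinite_union] at hC
    rcases hC with hC | hC
    · exact ⟨_, inter_subset_left, hC, 0, Or.inl fun m hm _ => hm.2⟩
    · exact ⟨_, sdiff_subset, hC, 0, Or.inr fun m hm _ => hm.2⟩
  · rintro i C ⟨N, h⟩ C' hC'
    exact ⟨N, h.imp (fun h m hm => h m (hC' hm)) fun h m hm => h m (hC' hm)⟩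
  · rintro i N C ⟨N', h⟩
    exact ⟨N + N', h.imp
      (fun h m hm hlt => h m ⟨hm, show N < m by omega⟩ (by omega))
      (fun h m hm hlt => h m ⟨hm, show N < m by omega⟩ (by omega))⟩

/-! ### Building two branches with common promises -/

/-- Two generic branches through a family of finite conditions with common promises. -/
theorem exists_generic_branches (x : ℕ → Set (List ℕ))
    (G : List ℕ → Finset (ℕ × List ℕ) → Prop)
    (hext : ∀ t F, G t F → ∃ i, G (t ++ [i]) F)
    (hchild : ∀ t t' F, G t F → G t' F → ∀ u ∈ F, [] ∉ sectionAt (x u.1) u.2 → ∀ N, ∃ m, N < m ∧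
      G t (insert (childNode x u m) F) ∧ G t' (insert (childNode x u m) F))
    (hpair : ∀ t t' F, G t F → G t' F → ∀ N, ∃ l m, N < m ∧
      G t (insert (pairNode x l m) F) ∧ G t' (insert (pairNode x l m) F))
    {t₀ t₀' : List ℕ} (h₀ : G t₀ ∅) (h₀' : G t₀' ∅) :
    ∃ (y y' : ℕ → ℕ) (U : Set (ℕ × List ℕ)), Extends y t₀ ∧ Extends y' t₀' ∧
      (∀ u ∈ U, ∀ n, ∃ t F, n ≤ t.length ∧ Extends y t ∧ u ∈ F ∧ G t F) ∧
      (∀ u ∈ U, ∀ n, ∃ t F, n ≤ t.length ∧ Extends y' t ∧ u ∈ F ∧ G t F) ∧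
      (∀ u ∈ U, [] ∉ sectionAt (x u.1) u.2 → ∀ N, ∃ m, N < m ∧ childNode x u m ∈ U) ∧
      ∀ N, ∃ l m, N < m ∧ pairNode x l m ∈ U := by
  let P := {p : List ℕ × List ℕ × Finset (ℕ × List ℕ) // G p.1 p.2.2 ∧ G p.2.1 p.2.2}
  let r : P → P → Prop := fun p q =>
    p.1.1 <+: q.1.1 ∧ p.1.2.1 <+: q.1.2.1 ∧ p.1.2.2 ⊆ q.1.2.2
  have hrrefl : ∀ p, r p p := fun p => ⟨List.prefix_rfl, List.prefix_rfl, Finset.Subset.refl _⟩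
  have hrtrans : ∀ p q s, r p q → r q s → r p s := fun p q s h h' =>
    ⟨h.1.trans h'.1, h.2.1.trans h'.2.1, h.2.2.trans h'.2.2⟩
  let 𝒟len : ℕ → Set P := fun n => {p | n ≤ p.1.1.length ∧ n ≤ p.1.2.1.length}
  -- Vacuous for a node not yet promised; the requirement is met again after the node has entered.
  let 𝒟child : (ℕ × List ℕ) × ℕ → Set P := fun i => {p | i.1 ∈ p.1.2.2 →
    [] ∉ sectionAt (x i.1.1) i.1.2 → ∃ m, i.2 < m ∧ childNode x i.1 m ∈ p.1.2.2}
  let 𝒟pair : ℕ → Set P := fun N => {p | ∃ l m, N < m ∧ pairNode x l m ∈ p.1.2.2}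
  obtain ⟨f, hf0, hfr, hf⟩ := exists_chain (ι := ℕ ⊕ ((ℕ × List ℕ) × ℕ) ⊕ ℕ) r
    (Sum.elim 𝒟len (Sum.elim 𝒟child 𝒟pair)) (by
      rintro (n | i | N) p
      · simp only [Sum.elim_inl]
        induction n with
        | zero => exact ⟨p, hrrefl p, Nat.zero_le _, Nat.zero_le _⟩
        | succ n ih =>
          obtain ⟨⟨⟨t, t', F⟩, h1, h2⟩, hr, hl, hl'⟩ := ih
          obtain ⟨i, hi⟩ := hext t F h1
          obtain ⟨i', hi'⟩ := hext t' F h2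
          refine ⟨⟨⟨t ++ [i], t' ++ [i'], F⟩, hi, hi'⟩, hrtrans _ _ _ hr
            ⟨List.prefix_append _ _, List.prefix_append _ _, Finset.Subset.refl _⟩, ?_, ?_⟩
          · simpa using hl
          · simpa using hl'
      · obtain ⟨⟨t, t', F⟩, h1, h2⟩ := p
        by_cases h : i.1 ∈ F ∧ [] ∉ sectionAt (x i.1.1) i.1.2
        · obtain ⟨m, hm, hG, hG'⟩ := hchild t t' F h1 h2 i.1 h.1 h.2 i.2
          exact ⟨⟨⟨t, t', _⟩, hG, hG'⟩, ⟨List.prefix_rfl, List.prefix_rfl,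
            Finset.subset_insert _ _⟩, fun _ _ => ⟨m, hm, Finset.mem_insert_self _ _⟩⟩
        · exact ⟨_, hrrefl _, fun h1 h2 => absurd ⟨h1, h2⟩ h⟩
      · obtain ⟨⟨t, t', F⟩, h1, h2⟩ := p
        obtain ⟨l, m, hm, hG, hG'⟩ := hpair t t' F h1 h2 N
        exact ⟨⟨⟨t, t', _⟩, hG, hG'⟩, ⟨List.prefix_rfl, List.prefix_rfl,
          Finset.subset_insert _ _⟩, l, m, hm, Finset.mem_insert_self _ _⟩)
    ⟨(t₀, t₀', ∅), h₀, h₀'⟩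
  have hmono : ∀ m n, m ≤ n → r (f m) (f n) := fun m n hmn => by
    induction n, hmn using Nat.le_induction with
    | base => exact hrrefl _
    | succ n _ ih => exact hrtrans _ _ _ ih (hfr n)
  have hlen : ∀ N k, ∃ n, k < n ∧ N ≤ (f n).1.1.length ∧ N ≤ (f n).1.2.1.length :=
    fun N k => hf (Sum.inl N) k
  obtain ⟨y, hy⟩ := exists_extends_of_chain (fun n => (f n).1.1) (fun n => (hfr n).1)
    fun N => (hlen N 0).imp fun n h => h.2.1
  obtain ⟨y', hy'⟩ := exists_extends_of_chain (fun n => (f n).1.2.1) (fun n => (hfr n).2.1)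
    fun N => (hlen N 0).imp fun n h => h.2.2
  refine ⟨y, y', {u | ∃ n, u ∈ (f n).1.2.2}, ?_, ?_, ?_, ?_, ?_, ?_⟩
  · simpa [hf0] using hy 0
  · simpa [hf0] using hy' 0
  · rintro u ⟨k, hk⟩ n
    obtain ⟨j, hkj, hj, _⟩ := hlen n k
    exact ⟨_, _, hj, hy j, (hmono k j hkj.le).2.2 hk, (f j).2.1⟩
  · rintro u ⟨k, hk⟩ n
    obtain ⟨j, hkj, _, hj⟩ := hlen n k
    exact ⟨_, _, hj, hy' j, (hmono k j hkj.le).2.2 hk, (f j).2.2⟩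
  · rintro u ⟨k, hk⟩ hu N
    obtain ⟨j, hkj, hj⟩ := hf (Sum.inr (Sum.inl (u, N))) k
    obtain ⟨m, hm, hmem⟩ := hj ((hmono k j hkj.le).2.2 hk) hu
    exact ⟨m, hm, j, hmem⟩
  · intro N
    obtain ⟨j, _, l, m, hm, hmem⟩ := hf (Sum.inr (Sum.inr N)) 0
    exact ⟨l, m, hm, j, hmem⟩

/-- If `A` is positive in only finitely many `x l`, then along a sufficiently sparse set it is
not positive at any node of length one. -/
theorem exists_forall_not_nodePos (hx : ∀ l, FullFront (x l)) (hnil : ∀ l, [] ∉ x l)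
    {A : Set (List ℕ)} {l₀ : ℕ} (hA : ∀ l, l₀ < l → ¬ Positive (x l ∩ A)) {B : Set ℕ}
    (hB : B.Infinite) : ∃ D ⊆ B, D.Infinite ∧ ∀ l ∈ D, ∀ m ∈ D, l < m →
      ¬ NodePos x univ A (pairNode x l m) := by
  obtain ⟨D, hDB, hD, h⟩ := exists_homogeneous (B ∩ Ioi l₀) (infinite_inter_Ioi hB l₀)
    (fun l m => ¬ NodePos x univ A (pairNode x l m)) (by
      rintro l ⟨-, hl⟩
      have hinj := (child_strictMono ((hx l).succs_infinite (hnil l))).injective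
      have hfin : {m | NodePos x univ A (pairNode x l m)}.Finite := by
        by_contra hinf
        refine hA l hl ((PosAlong.node (D := univ) _ (hnil l) hinf (subset_univ _)
          fun m hm => hm).positive (hx l))
      obtain ⟨N, hN⟩ := hfin.bddAbove
      exact ⟨N, fun m _ hm h => absurd (hN h) (not_le.2 hm)⟩)
  exact ⟨D, hDB.trans inter_subset_left, hD, h⟩

/-- If all infinite subsets of `W` are caught by some `φ y`, and no `φ y` is positive in more than
finitely many `x l`, then there are `y`, `y'` with `φ y ≠ φ y'` and positive intersection. -/
theorem exists_positive_inter (hx : ∀ l, FullFront (x l)) (hnil : ∀ l, [] ∉ x l)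
    (hφ : LocallyDecided φ) (hfew : ∀ y, ∃ l₀, ∀ l, l₀ < l → ¬ Positive (x l ∩ φ y))
    {W : Set ℕ} (hW : W.Infinite) (hcatch : ∀ C ⊆ W, C.Infinite → ∃ y, Catches x C (φ y) ∅) :
    ∃ y y', φ y ≠ φ y' ∧ Positive (φ y ∩ φ y') := by
  obtain ⟨B₁, hB₁W, hB₁, hdec⟩ := exists_forall_neverCaught x φ hW
  -- After this second thinning, for each condition and each `l`, promising `pairNode x l m` is
  -- possible for almost all `m ∈ B` or for almost none.
  obtain ⟨B, hBB₁, hB, hhom⟩ := exists_forall_almost_subset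
    (fun i : (List ℕ × Finset (ℕ × List ℕ)) × ℕ =>
      {m | ¬ NeverCaught x φ i.1.1 (insert (pairNode x i.2 m) i.1.2) B₁}) hB₁
  have hlarge : ∀ t F, ¬ NeverCaught x φ t F B₁ → ∀ C ⊆ B, C.Infinite →
      ∃ D ⊆ C, D.Infinite ∧ ∃ y, Extends y t ∧ Catches x D (φ y) F := fun t F h C hC hCi => by
    have h' : ¬ NeverCaught x φ t F C := fun h' => h (hdec t F C (hC.trans hBB₁) hCi h')
    simpa [NeverCaught] using h'
  have hsmall : ∀ t F, (∃ D ⊆ B, D.Infinite ∧ ∃ y, Extends y t ∧ Catches x D (φ y) F) →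
      ¬ NeverCaught x φ t F B₁ := by
    rintro t F ⟨D, hD, hDi, y, hy, h⟩ hs
    exact hs D (hD.trans hBB₁) hDi y hy h
  -- conditions can be extended
  have hext : ∀ t F, ¬ NeverCaught x φ t F B₁ → ∃ i, ¬ NeverCaught x φ (t ++ [i]) F B₁ := fun t F h => by
    obtain ⟨D, hD, hDi, y, hy, hc⟩ := hlarge t F h B Subset.rfl hB
    exact ⟨_, hsmall _ _ ⟨D, hD, hDi, y, hy.concat, hc⟩⟩
  -- If infinitely many indices were bad, some `φ y` would catch the condition on an infinite set
  -- `D` of bad indices. Positivity of `u` along `D` then gives a positive successor with index in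
  -- `D`.
  have hchild : ∀ t F, ¬ NeverCaught x φ t F B₁ → ∀ u ∈ F, [] ∉ sectionAt (x u.1) u.2 →
      {m ∈ B | NeverCaught x φ t (insert (childNode x u m) F) B₁}.Finite := fun t F h u hu h0 => by
    by_contra hinf
    obtain ⟨D, hD, hDi, y, hy, hc⟩ := hlarge t F h _ (fun m hm => hm.1) hinf
    obtain ⟨m, hmD, hm⟩ := ((hc.2 u hu).infinite h0).nonempty
    exact hsmall _ _ ⟨D, fun i hi => (hD hi).1, hDi, y, hy,
      hc.insert (nodePos_childNode_iff.2 hm)⟩ (hD hmD).2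
  have hpair : ∀ t F, ¬ NeverCaught x φ t F B₁ → {l ∈ B | ¬ ∃ N, ∀ m ∈ B, N < m →
      ¬ NeverCaught x φ t (insert (pairNode x l m) F) B₁}.Finite := fun t F h => by
    by_contra hinf
    -- By `hhom`, a bad `l` admits almost no `m`, so `E` can be thinned until no pair `l < m` from
    -- it is promisable; a consecutive pair of a caught `D ⊆ E` contradicts this.
    obtain ⟨E, hEs, hE, hEsmall⟩ := exists_homogeneous _ hinf
      (fun l m => NeverCaught x φ t (insert (pairNode x l m) F) B₁) (by
        rintro l ⟨hl, hl'⟩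
        obtain ⟨N, hN | hN⟩ := hhom ((t, F), l)
        · exact absurd ⟨N, hN⟩ hl'
        · exact ⟨N, fun m hm hlt => not_not.1 (hN m hm.1 hlt)⟩)
    have hEB : E ⊆ B := fun m hm => (hEs hm).1
    obtain ⟨D, hD, hDi, y, hy, hc⟩ := hlarge t F h E hEB hE
    obtain ⟨l, m, _, hlm, hpos⟩ := hc.1 0
    exact hsmall _ _ ⟨D, hD.trans hEB, hDi, y, hy, hc.insert hpos⟩
      (hEsmall l (hD hlm.1) m (hD hlm.mem_right) hlm.lt)
  -- a condition below which two members of the family differ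
  have hbranch : ∀ C ⊆ B, C.Infinite → ∃ y, Catches x C (φ y) ∅ ∧
      ∀ t, Extends y t → ¬ NeverCaught x φ t ∅ B₁ := fun C hC hCi => by
    obtain ⟨y, hy⟩ := hcatch C (hC.trans (hBB₁.trans hB₁W)) hCi
    exact ⟨y, hy, fun t ht => hsmall _ _ ⟨C, hC, hCi, y, ht, hy⟩⟩
  obtain ⟨t₀, t₀', hG, hG', hne⟩ : ∃ t t', ¬ NeverCaught x φ t ∅ B₁ ∧ ¬ NeverCaught x φ t' ∅ B₁ ∧
      ∀ z z', Extends z t → Extends z' t' → φ z ≠ φ z' := by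
    obtain ⟨y, -, hy⟩ := hbranch B Subset.rfl hB
    obtain ⟨l₀, hl₀⟩ := hfew y
    -- `E` is chosen so that `φ y` cannot catch it; whichever `φ y'` does is therefore a different
    -- set.
    obtain ⟨E, hEB, hE, hEpos⟩ := exists_forall_not_nodePos hx hnil hl₀ hB
    obtain ⟨y', hc, hy'⟩ := hbranch E hEB hE
    have hyy' : φ y ≠ φ y' := fun heq => by
      obtain ⟨l, m, _, hlm, hpos⟩ := hc.1 0
      rw [← heq] at hpos
      exact hEpos l hlm.1 m hlm.mem_right hlm.lt (hpos.of_sdiff_finite (by simp))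
    obtain ⟨v, hv⟩ : ∃ v, ¬ (v ∈ φ y ↔ v ∈ φ y') := by
      by_contra! h
      exact hyy' (Set.ext h)
    obtain ⟨n, hn⟩ := hφ y v
    obtain ⟨n', hn'⟩ := hφ y' v
    refine ⟨_, _, hy _ (extends_ofFn y n), hy' _ (extends_ofFn y' n'), fun z z' hz hz' heq => hv ?_⟩
    rw [← hn z fun i hi => (extends_ofFn y n).agree hz (by simpa using hi),
      ← hn' z' fun i hi => (extends_ofFn y' n').agree hz' (by simpa using hi), heq]
  obtain ⟨y, y', U, hy, hy', hU, hU', hUchild, hUpair⟩ := exists_generic_branches x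
    (fun t F => ¬ NeverCaught x φ t F B₁) hext
    (fun t t' F h h' u hu h0 N => by
      obtain ⟨m, hm, hmN⟩ := (hB.sdiff ((hchild t F h u hu h0).union
        (hchild t' F h' u hu h0))).exists_gt N
      exact ⟨m, hmN, fun hs => hm.2 (Or.inl ⟨hm.1, hs⟩), fun hs => hm.2 (Or.inr ⟨hm.1, hs⟩)⟩)
    (fun t t' F h h' N => by
      obtain ⟨l, hlB, hl⟩ := (hB.sdiff ((hpair t F h).union (hpair t' F h'))).nonempty
      obtain ⟨N₁, h₁⟩ : ∃ N, ∀ m ∈ B, N < m →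
          ¬ NeverCaught x φ t (insert (pairNode x l m) F) B₁ := by
        by_contra hs
        exact hl (Or.inl ⟨hlB, hs⟩)
      obtain ⟨N₂, h₂⟩ : ∃ N, ∀ m ∈ B, N < m →
          ¬ NeverCaught x φ t' (insert (pairNode x l m) F) B₁ := by
        by_contra hs
        exact hl (Or.inr ⟨hlB, hs⟩)
      obtain ⟨m, hm, hlt⟩ := hB.exists_gt (N + N₁ + N₂)
      exact ⟨l, m, by omega, h₁ m hm (by omega), h₂ m hm (by omega)⟩) hG hG'
  refine ⟨y, y', hne y y' hy hy', ?_⟩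
  -- A promised leaf lies in `φ z'` for some `z'` agreeing with `z` as far as is needed to decide
  -- membership, hence in `φ z`.
  have hleaf : ∀ z : ℕ → ℕ, (∀ u ∈ U, ∀ n, ∃ t F, n ≤ t.length ∧ Extends z t ∧ u ∈ F ∧
      ¬ NeverCaught x φ t F B₁) → ∀ u ∈ U, [] ∈ sectionAt (x u.1) u.2 → u.2 ∈ φ z :=
    fun z hz u hu h0 => by
      obtain ⟨n, hn⟩ := hφ z u.2
      obtain ⟨t, F, hlen, hzt, huF, hs⟩ := hz u hu n
      obtain ⟨D, _, _, z', hz't, hc⟩ := hlarge t F hs B Subset.rfl hB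
      have hmem : [] ∈ sectionAt (φ z') u.2 := (hc.2 u huF).nil_mem h0
      rw [← hn z' fun i hi => hzt.agree hz't (by omega)]
      simpa [sectionAt] using hmem
  have hfull : ∀ u ∈ U, FullFront (sectionAt (x u.1) u.2) := fun u hu => by
    obtain ⟨t, F, _, _, huF, hs⟩ := hU u hu 0
    obtain ⟨D, _, _, z', _, hc⟩ := hlarge t F hs B Subset.rfl hB
    exact (hx u.1).of_nonempty _ (hc.2 u huF).nonempty
  -- The front is kept as a separate variable so that the induction runs over it while `u` varies in
  -- `U`.
  have hpos : ∀ X, FullFront X → ∀ u ∈ U, X = sectionAt (x u.1) u.2 →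
      Positive (sectionAt (φ y ∩ φ y') u.2) := fun X hX => by
    have hl : ∀ u ∈ U, [] ∈ sectionAt (x u.1) u.2 → Positive (sectionAt (φ y ∩ φ y') u.2) :=
      fun u hu h0 => .leaf (by
        simpa [sectionAt] using ⟨hleaf y hU u hu h0, hleaf y' hU' u hu h0⟩)
    induction hX with
    | leaf => exact fun u hu h => hl u hu (h ▸ rfl)
    | @node X h0 hinf _ ih =>
      rintro u hu rfl
      have hinj := (child_strictMono hinf).injective
      refine .node (child (sectionAt (x u.1) u.2) '' {m | childNode x u m ∈ U})
        ((infinite_of_forall_exists_gt fun N => ?_).image hinj.injOn) ?_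
      · obtain ⟨m, hm, hmU⟩ := hUchild u hu h0 N
        exact ⟨m, hmU, hm⟩
      · rintro _ ⟨m, hm, rfl⟩
        have := ih _ (child_mem hinf m) _ hm (sectionAt_sectionAt _ _ _)
        rw [sectionAt_sectionAt]
        exact this
  refine .node {k | ∃ l m, child (x l) m = k ∧ pairNode x l m ∈ U} ?_ ?_
  · refine infinite_of_forall_exists_gt fun N => ?_
    obtain ⟨l, m, hm, hmU⟩ := hUpair N
    exact ⟨_, ⟨l, m, rfl, hmU⟩,
      hm.trans_le ((child_strictMono ((hx l).succs_infinite (hnil l))).id_le m)⟩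
  · rintro _ ⟨l, m, rfl, hmU⟩
    exact hpos _ (hfull _ hmU) _ hmU rfl

end

/-! ### The theorem -/

theorem theoremt (L : LadderSystem) (α : Ordinal.{0}) (hα0 : 0 < α) (hα1 : α < ω₁)
    (𝒜 : Set (Set (List ℕ))) (h𝒜 : L.IsAlmostDisjointFamily α 𝒜) (hana : IsAnalyticFamily 𝒜)
    (x : ℕ → Set (List ℕ)) (hx : ∀ l, x l ∈ L.finPosPos α)
    (hdisj : ∀ k l, k ≠ l → Disjoint (x k) (x l))
    (hsub : ∃ B : ℕ → Set (List ℕ), Function.Injective B ∧ ∀ l, B l ∈ 𝒜 ∧ x l ⊆ B l) :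
    (∀ W : Set ℕ, W.Infinite → ∃ W₀ : Set ℕ, W₀ ⊆ W ∧ W₀.Infinite ∧
      ∀ A ∈ 𝒜, L.tilde α x W₀ ∩ A ∈ L.finIdeal α) ∧
    ¬ Maximal (L.IsAlmostDisjointFamily α) 𝒜 := by
  obtain ⟨B, hBinj, hB⟩ := hsub
  have hfull : ∀ l, FullFront (x l) := fun l => L.fullFront_of_mem_finPosPos hα0 hα1 (hx l)
  have hxS : ∀ l, x l ⊆ L.S α := fun l => (hx l).1.1
  have hnil : ∀ l, [] ∉ x l := fun l => L.nil_notMem hα0 (hxS l)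
  have hsmall : ∀ A ∈ 𝒜, ∀ A' ∈ 𝒜, A ≠ A' → ¬ Positive (A ∩ A') := fun A hA A' hA' hne h =>
    (L.notMem_finIdeal_iff hα0 hα1 (inter_subset_left.trans (h𝒜.1 A hA).1)).2 h
      (h𝒜.2 A hA A' hA' hne)
  have key : ∀ W : Set ℕ, W.Infinite → ∃ W₀ : Set ℕ, W₀ ⊆ W ∧ W₀.Infinite ∧
      ∀ A ∈ 𝒜, L.tilde α x W₀ ∩ A ∈ L.finIdeal α := by
    intro W hW
    by_contra! hcon
    obtain ⟨φ, hφ, hrange⟩ := hana.exists_locallyDecided ⟨B 0, (hB 0).1⟩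
    have hmem : ∀ y, φ y ∈ 𝒜 := fun y => hrange ▸ mem_range_self y
    -- If `φ y` is positive in `x l ⊆ B l`, almost disjointness gives `φ y = B l`; injectivity of
    -- `B` leaves at most one such `l`.
    obtain ⟨y, y', hne, hpos⟩ := exists_positive_inter hfull hnil hφ (fun y => by
      have hone : ∀ l, φ y ≠ B l → ¬ Positive (x l ∩ φ y) := fun l hl h =>
        hsmall _ (hB l).1 _ (hmem y) hl.symm (h.mono (inter_subset_inter_left _ (hB l).2))
      by_cases h : ∃ l, φ y = B l
      · obtain ⟨l₀, hl₀⟩ := h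
        exact ⟨l₀, fun l hl => hone l fun h => hl.ne (hBinj (hl₀.symm.trans h))⟩
      · exact ⟨0, fun l _ => hone l fun hl => h ⟨l, hl⟩⟩) hW (fun C hCW hC => by
      obtain ⟨A, hA, hnot⟩ := hcon C hCW hC
      obtain ⟨y, rfl⟩ : A ∈ range φ := hrange ▸ hA
      have hpos := (L.notMem_finIdeal_iff hα0 hα1
        (inter_subset_left.trans (L.tilde_subset_S x C))).1 hnot
      exact ⟨y, L.exists_consec_nodePos hα0 hfull hxS hpos, by simp⟩)
    exact hsmall _ (hmem y) _ (hmem y') hne hpos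
  refine ⟨key, fun hmax => ?_⟩
  obtain ⟨W₀, _, hW₀, h⟩ := key univ infinite_univ
  have hT : L.tilde α x W₀ ∈ L.finPos α := ⟨L.tilde_subset_S x W₀,
    (L.notMem_finIdeal_iff hα0 hα1 (L.tilde_subset_S x W₀)).2
      (L.positive_tilde hα0 hfull hxS hW₀)⟩
  have hins : L.IsAlmostDisjointFamily α (insert (L.tilde α x W₀) 𝒜) := by
    constructor
    · rintro A (rfl | hA)
      · exact hT
      · exact h𝒜.1 A hA
    · rintro A (rfl | hA) A' (rfl | hA') hne
      · exact absurd rfl hne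
      · exact h A' hA'
      · rw [inter_comm]
        exact h A hA
      · exact h𝒜.2 A hA A' hA' hne
  have hmem := hmax.2 hins (subset_insert _ _) (mem_insert (L.tilde α x W₀) 𝒜)
  have := h _ hmem
  rw [inter_self] at this
  exact hT.2 this
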